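/- Let $\mu$ be the unique Borel probability measure on $\mathbb{R}$ with $\mu(E)=\frac12\left(\mu(\tau_0^{-1}E)+\mu(\tau_2^{-1}E)\right)$ for all Borel sets $E$, where $\tau_0(x)=\frac{x}{4}$ and $\tau_2(x)=\frac{x+2}{4}$. For an odd natural number $m$ put $$\Gamma(m)=\left\{\sum_{k=0}^n 4^k l_k : l_k\in\{0,m\},\ n\in\mathbb{N}\right\}.$$ Call $m$ complete if the exponentials $e_\lambda(x)=e^{2\pi i\lambda x}$, $\lambda\in\Gamma(m)$, form an orthonormal basis of $L^2(\mu)$, and incomplete otherwise. Call an odd number $m$ primitive if $m$ is incomplete and every proper divisor of $m$ is complete. Let $o_4(m)$ denote the order of $4$ in the multiplicative group of $\mathbb{Z}/m\mathbb{Z}$, i.e. the smallest integer $k\geq 1$ with $4^k\equiv 1 \pmod m$. Let $a,b\geq 1$ be odd numbers such that $o_4(ab)\geq\frac{2a+15}{12}\,o_4(b)$. Then $ab$ is not primitive. -/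

import Mathlib

open MeasureTheory
open scoped ENNReal

noncomputable section

namespace CantorFour

/-- The fair coin: mass `1/2` at each of the two outcomes. -/
def coin : Measure Bool :=
  (2⁻¹ : ℝ≥0∞) • (Measure.dirac false + Measure.dirac true)

instance : IsProbabilityMeasure coin := by
  constructor
  simp only [coin, Measure.smul_apply, Measure.add_apply, measure_univ, smul_eq_mul]
  rw [one_add_one_eq_two]
  exact ENNReal.inv_mul_cancel (by simp) (by simp)

/-- The base-4 digit attached to an outcome of the coin: `0` or `2`. -/
def digit (b : Bool) : ℝ := if b then 2 else 0

/-- The point `∑_{k ≥ 1} 4^{-k} b_k` of the Cantor set `X₄`, whose digits `b_k ∈ {0, 2}` are read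
from `ω` (with `b_k = digit (ω (k - 1))`). -/
def cantorPoint (ω : ℕ → Bool) : ℝ := ∑' k : ℕ, digit (ω k) / 4 ^ (k + 1)

/-- The maps `τ_0 x = x / 4` and `τ_2 x = (x + 2) / 4` of the iterated function system. -/
def tau (b : Bool) (x : ℝ) : ℝ := (x + digit b) / 4

/-- The measure `μ` on the Cantor set `X₄`: the law of `∑_{k ≥ 1} 4^{-k} b_k` with independent
digits `b_k`, each equal to `0` or `2` with probability `1/2`. By `cantorMeasure_invariant` and
`eq_cantorMeasure` below it is the unique Borel probability measure invariant under the iterated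
function system `τ_0, τ_2`. -/
def cantorMeasure : Measure ℝ := (Measure.infinitePi (fun _ : ℕ => coin)).map cantorPoint

lemma digit_abs_le (b : Bool) : |digit b| ≤ 2 := by
  cases b <;> simp [digit]

lemma norm_term_le (ω : ℕ → Bool) (k : ℕ) :
    ‖digit (ω k) / 4 ^ (k + 1)‖ ≤ 2 * (1 / 4 : ℝ) ^ k := by
  rw [norm_div, Real.norm_eq_abs, norm_pow, Real.norm_ofNat, div_pow, one_pow, mul_one_div]
  gcongr
  · exact digit_abs_le _
  · norm_num
  · omega

lemma summable_bound : Summable (fun k : ℕ => 2 * (1 / 4 : ℝ) ^ k) :=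
  (summable_geometric_of_lt_one (by norm_num) (by norm_num)).mul_left 2

lemma summable_term (ω : ℕ → Bool) : Summable (fun k : ℕ => digit (ω k) / 4 ^ (k + 1)) :=
  Summable.of_norm_bounded summable_bound (norm_term_le ω)

lemma measurable_cantorPoint : Measurable cantorPoint := by
  have hc : Continuous cantorPoint := by
    refine continuous_tsum (fun k => ?_) summable_bound (fun k ω => norm_term_le ω k)
    exact ((continuous_of_discreteTopology (f := digit)).comp (continuous_apply k)).div_const _
  exact hc.measurable

instance : IsProbabilityMeasure cantorMeasure :=
  Measure.isProbabilityMeasure_map measurable_cantorPoint.aemeasurable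

/-- The sequence `b, ω 0, ω 1, …`. -/
def cons (b : Bool) (ω : ℕ → Bool) : ℕ → Bool
  | 0 => b
  | k + 1 => ω k

lemma measurable_cons (b : Bool) : Measurable (cons b) := by
  refine measurable_pi_lambda _ (fun k => ?_)
  cases k with
  | zero => exact measurable_const
  | succ k => exact measurable_pi_apply k

lemma cantorPoint_cons (b : Bool) (ω : ℕ → Bool) :
    cantorPoint (cons b ω) = tau b (cantorPoint ω) := by
  have h := (summable_term (cons b ω)).tsum_eq_zero_add
  have h2 : ∀ k : ℕ, digit (cons b ω (k + 1)) / 4 ^ (k + 1 + 1)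
      = digit (ω k) / 4 ^ (k + 1) / 4 := by
    intro k
    rw [pow_succ (4 : ℝ) (k + 1), div_div]
    rfl
  simp only [h2, tsum_div_const] at h
  rw [cantorPoint, h, tau, cantorPoint]
  simp only [cons]
  ring

lemma infinitePi_coin :
    Measure.infinitePi (fun _ : ℕ => coin)
      = (2⁻¹ : ℝ≥0∞) • ((Measure.infinitePi (fun _ : ℕ => coin)).map (cons false)
          + (Measure.infinitePi (fun _ : ℕ => coin)).map (cons true)) := by
  symm
  refine Measure.eq_infinitePi _ (fun s t ht => ?_)
  set P := Measure.infinitePi (fun _ : ℕ => coin) with hP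
  set s' : Finset ℕ := s.preimage Nat.succ Nat.succ_injective.injOn with hs'
  have hprod : ∏ i ∈ s.erase 0, coin (t i) = ∏ j ∈ s', coin (t (j + 1)) := by
    have : s.erase 0 = s'.map ⟨Nat.succ, Nat.succ_injective⟩ := by
      ext i
      cases i <;> simp [hs']
    rw [this, Finset.prod_map]
    rfl
  have hbox : P (Set.pi s' (fun j => t (j + 1))) = ∏ i ∈ s.erase 0, coin (t i) := by
    rw [hprod, hP, Measure.infinitePi_pi _ (fun i _ => ht (i + 1))]
  have hms : MeasurableSet (Set.pi (s : Set ℕ) t) :=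
    MeasurableSet.pi s.countable_toSet (fun i _ => ht i)
  have hmem : ∀ (b : Bool) (ω : ℕ → Bool), cons b ω ∈ Set.pi (s : Set ℕ) t ↔
      (0 ∈ s → b ∈ t 0) ∧ ω ∈ Set.pi (s' : Set ℕ) (fun j => t (j + 1)) := by
    intro b ω
    simp only [Set.mem_pi, Finset.mem_coe, hs', Finset.mem_preimage]
    refine ⟨fun h => ⟨fun h0 => h 0 h0, fun i hi => h (i + 1) hi⟩, fun h i hi => ?_⟩
    cases i with
    | zero => exact h.1 hi
    | succ i => exact h.2 i hi
  rw [Measure.smul_apply, Measure.add_apply, Measure.map_apply (measurable_cons _) hms,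
    Measure.map_apply (measurable_cons _) hms, smul_eq_mul]
  by_cases h0 : 0 ∈ s
  · have key : ∀ b : Bool, P (cons b ⁻¹' Set.pi (s : Set ℕ) t)
        = Measure.dirac b (t 0) * ∏ i ∈ s.erase 0, coin (t i) := by
      intro b
      rw [Measure.dirac_apply' _ (ht 0)]
      by_cases hb : b ∈ t 0
      · have : cons b ⁻¹' Set.pi (s : Set ℕ) t = Set.pi (s' : Set ℕ) (fun j => t (j + 1)) := by
          ext ω
          simp only [Set.mem_preimage, hmem, h0, hb, true_and, forall_const]
        rw [this, hbox, Set.indicator_of_mem hb, Pi.one_apply, one_mul]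
      · have : cons b ⁻¹' Set.pi (s : Set ℕ) t = ∅ := by
          ext ω
          simp only [Set.mem_preimage, hmem, h0, hb, forall_const, false_and,
            Set.mem_empty_iff_false]
        rw [this, measure_empty, Set.indicator_of_notMem hb, zero_mul]
    rw [key, key, ← add_mul, ← mul_assoc, ← Finset.mul_prod_erase s _ h0]
    rfl
  · have key : ∀ b : Bool, P (cons b ⁻¹' Set.pi (s : Set ℕ) t) = ∏ i ∈ s, coin (t i) := by
      intro b
      have : cons b ⁻¹' Set.pi (s : Set ℕ) t = Set.pi (s' : Set ℕ) (fun j => t (j + 1)) := by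
        ext ω
        simp only [Set.mem_preimage, hmem, h0, false_imp_iff, true_and]
      rw [this, hbox, Finset.erase_eq_of_notMem h0]
    rw [key, key, ← two_mul, ← mul_assoc, ENNReal.inv_mul_cancel (by simp) (by simp), one_mul]

/-- The invariance equation `μ(E) = (μ(τ_0⁻¹ E) + μ(τ_2⁻¹ E)) / 2`. -/
theorem cantorMeasure_invariant (E : Set ℝ) (hE : MeasurableSet E) :
    cantorMeasure E = 2⁻¹ * (cantorMeasure (tau false ⁻¹' E) + cantorMeasure (tau true ⁻¹' E)) := by
  have hm : ∀ b, Measurable (tau b) := fun b => by unfold tau; fun_prop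
  have hp : ∀ b, cons b ⁻¹' (cantorPoint ⁻¹' E) = cantorPoint ⁻¹' (tau b ⁻¹' E) := fun b => by
    ext ω; simp only [Set.mem_preimage, cantorPoint_cons]
  rw [cantorMeasure, Measure.map_apply measurable_cantorPoint hE,
    Measure.map_apply measurable_cantorPoint (hm _ hE),
    Measure.map_apply measurable_cantorPoint (hm _ hE)]
  conv_lhs => rw [infinitePi_coin]
  have hE' := measurable_cantorPoint hE
  rw [Measure.smul_apply, Measure.add_apply, Measure.map_apply (measurable_cons _) hE',
    Measure.map_apply (measurable_cons _) hE', hp, hp, smul_eq_mul]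

/-- Uniqueness of the invariant probability measure. -/
theorem eq_cantorMeasure (ν : Measure ℝ) [IsProbabilityMeasure ν]
    (hν : ∀ E : Set ℝ, MeasurableSet E →
      ν E = 2⁻¹ * (ν (tau false ⁻¹' E) + ν (tau true ⁻¹' E))) :
    ν = cantorMeasure := by
  have hm : ∀ b, Measurable (tau b) := fun b => by unfold tau; fun_prop
  have hchar : ∀ (ρ : Measure ℝ) [IsProbabilityMeasure ρ],
      (∀ E : Set ℝ, MeasurableSet E →
        ρ E = 2⁻¹ * (ρ (tau false ⁻¹' E) + ρ (tau true ⁻¹' E))) →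
      ∀ t : ℝ, charFun ρ t = 2⁻¹ * (1 + Complex.exp (((t / 2 : ℝ) : ℂ) * Complex.I))
        * charFun ρ (t / 4) := by
    intro ρ _ hρ t
    have hmeas : ρ = (2⁻¹ : ℝ≥0∞) • (ρ.map (tau false) + ρ.map (tau true)) := by
      ext E hE
      rw [Measure.smul_apply, Measure.add_apply, Measure.map_apply (hm _) hE,
        Measure.map_apply (hm _) hE, smul_eq_mul, ← hρ E hE]
    have hmap : ∀ b, charFun (ρ.map (tau b)) t
        = Complex.exp (((t * digit b / 4 : ℝ) : ℂ) * Complex.I) * charFun ρ (t / 4) := by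
      intro b
      rw [charFun_apply_real, charFun_apply_real, integral_map (hm b).aemeasurable
        (by fun_prop), ← integral_const_mul]
      congr 1 with x
      rw [← Complex.exp_add]
      congr 1
      simp only [tau]
      push_cast
      ring
    have hi : ∀ b, Integrable (fun x : ℝ => Complex.exp (t * x * Complex.I)) (ρ.map (tau b)) := by
      intro b
      have := Measure.isProbabilityMeasure_map (μ := ρ) (hm b).aemeasurable
      refine Integrable.of_bound (by fun_prop) 1 (Filter.Eventually.of_forall fun x => ?_)
      rw [← Complex.ofReal_mul, Complex.norm_exp_ofReal_mul_I]
    have hsum : charFun ρ t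
        = 2⁻¹ * (charFun (ρ.map (tau false)) t + charFun (ρ.map (tau true)) t) := by
      conv_lhs => rw [hmeas]
      rw [charFun_apply_real, integral_smul_measure, integral_add_measure (hi _) (hi _),
        ← charFun_apply_real, ← charFun_apply_real, ENNReal.toReal_inv, ENNReal.toReal_ofNat,
        Complex.real_smul]
      push_cast
      rfl
    have h2 : t * 2 / 4 = t / 2 := by ring
    rw [hsum, hmap, hmap]
    simp only [digit, if_true, Bool.false_eq_true, if_false, h2]
    simp only [mul_zero, zero_div, Complex.ofReal_zero, zero_mul, Complex.exp_zero]
    ring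
  have h1 := hchar ν hν
  have h2 := hchar cantorMeasure cantorMeasure_invariant
  refine Measure.ext_of_charFun (funext fun t => ?_)
  have hstep : ∀ t : ℝ, ‖charFun ν t - charFun cantorMeasure t‖
      ≤ ‖charFun ν (t / 4) - charFun cantorMeasure (t / 4)‖ := by
    intro t
    rw [h1 t, h2 t, ← mul_sub, norm_mul]
    refine mul_le_of_le_one_left (norm_nonneg _) ?_
    rw [norm_mul, norm_inv, Complex.norm_ofNat]
    have := norm_add_le (1 : ℂ) (Complex.exp (((t / 2 : ℝ) : ℂ) * Complex.I))
    rw [Complex.norm_exp_ofReal_mul_I, norm_one] at this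
    linarith
  have hiter : ∀ n : ℕ, ‖charFun ν t - charFun cantorMeasure t‖
      ≤ ‖charFun ν (t * (1 / 4) ^ n) - charFun cantorMeasure (t * (1 / 4) ^ n)‖ := by
    intro n
    induction n with
    | zero => simp
    | succ n ih =>
      refine ih.trans ((hstep _).trans_eq ?_)
      rw [pow_succ, mul_one_div, mul_div_assoc]
  have hc : Continuous fun x : ℝ => ‖charFun ν x - charFun cantorMeasure x‖ :=
    (continuous_charFun.sub continuous_charFun).norm
  have hlim : Filter.Tendsto (fun n : ℕ => t * (1 / 4 : ℝ) ^ n) Filter.atTop (nhds 0) := by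
    simpa using (tendsto_pow_atTop_nhds_zero_of_lt_one (r := (1 / 4 : ℝ)) (by norm_num)
      (by norm_num)).const_mul t
  have hl := (hc.tendsto 0).comp hlim
  have hle := ge_of_tendsto' hl hiter
  simp only [charFun_zero, probReal_univ, sub_self, norm_zero] at hle
  exact sub_eq_zero.mp (norm_le_zero_iff.mp hle)

/-- The exponential function `e_lam(x) = e^{2πi lam x}`. -/
def expFun (lam : ℝ) (x : ℝ) : ℂ := Complex.exp (2 * Real.pi * Complex.I * lam * x)

lemma norm_expFun (lam x : ℝ) : ‖expFun lam x‖ = 1 := by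
  have h : (2 * Real.pi * Complex.I * lam * x : ℂ)
      = ((2 * Real.pi * lam * x : ℝ) : ℂ) * Complex.I := by push_cast; ring
  rw [expFun, h, Complex.norm_exp_ofReal_mul_I]

lemma memLp_expFun (lam : ℝ) : MemLp (expFun lam) 2 cantorMeasure := by
  refine MemLp.of_bound ?_ 1 (Filter.Eventually.of_forall fun x => (norm_expFun lam x).le)
  have h : Continuous (expFun lam) := by unfold expFun; fun_prop
  exact h.aestronglyMeasurable

/-- `e_lam` as a vector of the Hilbert space `L²(μ)`. -/
def expVec (lam : ℝ) : Lp ℂ 2 cantorMeasure := (memLp_expFun lam).toLp (expFun lam)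

/-- `Γ` is a spectrum for `μ`: the exponentials `e_lam`, `lam ∈ Γ`, form an orthonormal basis of
`L²(μ)`, that is, an orthonormal family whose linear span is dense. -/
def IsSpectrum (Γ : Set ℝ) : Prop :=
  Orthonormal ℂ (fun lam : Γ => expVec lam) ∧
    (Submodule.span ℂ (Set.range (fun lam : Γ => expVec lam))).topologicalClosure = ⊤

/-- `Γ(m) = {∑_{k=0}^n 4^k l_k : l_k ∈ {0, m}, n ∈ ℕ}`. -/
def Gam (m : ℕ) : Set ℝ :=
  {x | ∃ (n : ℕ) (l : ℕ → ℝ), (∀ k, l k = 0 ∨ l k = m) ∧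
    x = ∑ k ∈ Finset.range (n + 1), 4 ^ k * l k}

/-- The number `m` is complete if `Γ(m)` is a spectrum for `μ` (used for odd `m`). -/
def IsComplete (m : ℕ) : Prop := IsSpectrum (Gam m)

/-- The number `m` is primitive if it is odd and incomplete, while all its proper divisors are
complete. -/
def IsPrimitive (m : ℕ) : Prop :=
  Odd m ∧ ¬ IsComplete m ∧ ∀ d ∈ m.properDivisors, IsComplete d

/-- `o_4(m)`, the smallest positive `k` with `4^k ≡ 1 (mod m)` (for odd `m`). -/
def o4 (m : ℕ) : ℕ := orderOf (4 : ZMod m)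

end CantorFour

end

/-! Incompleteness is a statement about integer cycles. Let `Q t` be the squared norm of the
projection of `e_{-t}` onto the closed span of the `e_γ`, γ ∈ Γ(m). By Parseval it equals the sum of
|μ̂(t + γ)|², and sorting γ by its lowest digit gives a transfer equation with weights cos², sin² of
πt/2 and maps t ↦ t/4, t ↦ (t + m)/4. A maximum principle (`eq_zero_of_transfer`) forces `1 - Q = 0`
unless these maps have a nonzero integer cycle. Conversely, a cycle point x makes e_{-x} orthogonal
to every e_γ (`hat_cycle_add_gam`).

For a primitive m = ab every cycle point is coprime to m, since otherwise dividing the cycle by the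
common factor would make a proper divisor incomplete. As 4^i x_i ≡ x_0 mod m, the points x_i with i
< o₄(m) are distinct, and those whose index is a multiple of o₄(b) agree modulo b. This gives r =
o₄(ab)/o₄(b) distinct integers in (0, ab/3], in one class modulo b and each 0 or -m modulo 4. These
conditions leave only about a/6 places (`card_le_of_modEq`), whereas the hypothesis says r ≥ (2a +
15)/12. -/

noncomputable section

namespace CantorFour

/-! ### The Fourier transform of μ and its integer zeros -/

/-- The Fourier transform of the Cantor measure. -/
def hat (s : ℝ) : ℂ := ∫ x, expFun s x ∂cantorMeasure

lemma continuous_expFun (s : ℝ) : Continuous (expFun s) := by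
  unfold expFun; fun_prop

lemma expFun_add (s t x : ℝ) : expFun (s + t) x = expFun s x * expFun t x := by
  simp only [expFun, ← Complex.exp_add]
  congr 1
  push_cast
  ring

lemma expFun_neg (s x : ℝ) : expFun (-s) x = (starRingEnd ℂ) (expFun s x) := by
  simp only [expFun, ← Complex.exp_conj]
  congr 1
  simp [Complex.conj_ofNat]

lemma hat_zero : hat 0 = 1 := by
  simp [hat, expFun]

lemma hat_neg (s : ℝ) : hat (-s) = (starRingEnd ℂ) (hat s) := by
  simp only [hat, expFun_neg, integral_conj]

lemma measurable_tau (b : Bool) : Measurable (tau b) := by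
  unfold tau; fun_prop

lemma cantorMeasure_eq :
    cantorMeasure = (2⁻¹ : ℝ≥0∞) •
      (cantorMeasure.map (tau false) + cantorMeasure.map (tau true)) := by
  ext E hE
  rw [Measure.smul_apply, Measure.add_apply, Measure.map_apply (measurable_tau _) hE,
    Measure.map_apply (measurable_tau _) hE, smul_eq_mul, ← cantorMeasure_invariant E hE]

lemma expFun_tau (s : ℝ) (b : Bool) (x : ℝ) :
    expFun s (tau b x) = expFun (s / 4) (digit b) * expFun (s / 4) x := by
  simp only [expFun, tau, ← Complex.exp_add]
  congr 1
  push_cast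
  ring

lemma hat_eq (s : ℝ) : hat s = 2⁻¹ * (1 + expFun (s / 2) 1) * hat (s / 4) := by
  have hi : ∀ b, Integrable (expFun s) (cantorMeasure.map (tau b)) := by
    intro b
    have := Measure.isProbabilityMeasure_map (μ := cantorMeasure) (measurable_tau b).aemeasurable
    exact Integrable.of_bound (continuous_expFun s).aestronglyMeasurable 1
      (Filter.Eventually.of_forall fun x => (norm_expFun s x).le)
  have hm : ∀ b, ∫ x, expFun s x ∂(cantorMeasure.map (tau b))
      = expFun (s / 4) (digit b) * hat (s / 4) := by
    intro b
    rw [integral_map (measurable_tau b).aemeasurable (continuous_expFun s).aestronglyMeasurable]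
    simp only [expFun_tau, integral_const_mul, hat]
  have h1 : expFun (s / 4) (digit true) = expFun (s / 2) 1 := by
    simp only [expFun, digit]
    congr 1
    push_cast
    simp
    ring
  have h0 : expFun (s / 4) (digit false) = 1 := by
    simp [expFun, digit]
  conv_lhs => rw [hat, cantorMeasure_eq]
  rw [integral_smul_measure, integral_add_measure (hi _) (hi _), hm, hm, h0, h1,
    ENNReal.toReal_inv, ENNReal.toReal_ofNat, Complex.real_smul]
  push_cast
  ring

/-- With θ = πs/2, the factor (1 + e^{2iθ})/2 of `hat_eq` is cos θ · e^{iθ}. -/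
lemma norm_hat_sq (s : ℝ) :
    ‖hat s‖ ^ 2 = Real.cos (Real.pi * s / 2) ^ 2 * ‖hat (s / 4)‖ ^ 2 := by
  have h : ‖(2⁻¹ * (1 + expFun (s / 2) 1) : ℂ)‖ ^ 2 = Real.cos (Real.pi * s / 2) ^ 2 := by
    have e : (2⁻¹ * (1 + expFun (s / 2) 1) : ℂ)
        = (Real.cos (Real.pi * s / 2) : ℂ)
          * Complex.exp (((Real.pi * s / 2 : ℝ) : ℂ) * Complex.I) := by
      have h2 : expFun (s / 2) 1 = Complex.exp (((Real.pi * s / 2 : ℝ) : ℂ) * Complex.I) *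
          Complex.exp (((Real.pi * s / 2 : ℝ) : ℂ) * Complex.I) := by
        rw [expFun, ← Complex.exp_add]
        congr 1
        push_cast
        ring
      have hs := Complex.sin_sq (((Real.pi * s / 2 : ℝ) : ℂ))
      rw [h2, Complex.exp_mul_I, Complex.ofReal_cos]
      linear_combination (2⁻¹ * Complex.sin (((Real.pi * s / 2 : ℝ) : ℂ)) ^ 2) * Complex.I_sq
        - 2⁻¹ * hs
    rw [e, norm_mul, Complex.norm_exp_ofReal_mul_I, mul_one, Complex.norm_real,
      Real.norm_eq_abs, sq_abs]
  rw [hat_eq, norm_mul, mul_pow, h]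

lemma cos_sq_odd {n : ℤ} (hn : Odd n) (t : ℝ) :
    Real.cos (Real.pi * (t + n) / 2) ^ 2 = Real.sin (Real.pi * t / 2) ^ 2 := by
  obtain ⟨k, rfl⟩ := hn
  have : Real.pi * (t + ((2 * k + 1 : ℤ) : ℝ)) / 2
      = (Real.pi * t / 2 + Real.pi / 2) + k * Real.pi := by
    push_cast; ring
  rw [this, Real.cos_add_int_mul_pi, Real.cos_add_pi_div_two, mul_pow]
  have h : (((-1 : ℝ) ^ k) ^ 2) = 1 := by
    rw [← zpow_natCast, ← zpow_mul, mul_comm, zpow_mul]; simp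
  rw [h]; ring

lemma cos_sq_even {n : ℤ} (hn : Even n) (t : ℝ) :
    Real.cos (Real.pi * (t + n) / 2) ^ 2 = Real.cos (Real.pi * t / 2) ^ 2 := by
  obtain ⟨k, rfl⟩ := hn
  have : Real.pi * (t + ((k + k : ℤ) : ℝ)) / 2 = Real.pi * t / 2 + k * Real.pi := by
    push_cast; ring
  rw [this, Real.cos_add_int_mul_pi, mul_pow]
  have h : (((-1 : ℝ) ^ k) ^ 2) = 1 := by
    rw [← zpow_natCast, ← zpow_mul, mul_comm, zpow_mul]; simp
  rw [h, one_mul]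

lemma hat_odd {n : ℤ} (hn : Odd n) : hat n = 0 := by
  have h := norm_hat_sq n
  have hc := cos_sq_odd hn 0
  simp only [zero_add, mul_zero, zero_div, Real.sin_zero] at hc
  rw [hc] at h
  simpa using h

lemma hat_four_mul {n : ℤ} (hn : hat n = 0) : hat ((4 * n : ℤ) : ℝ) = 0 := by
  have h := hat_eq ((4 * n : ℤ) : ℝ)
  rw [h]
  push_cast
  rw [mul_div_cancel_left₀ _ (by norm_num), hn, mul_zero]

/-! ### Exponentials as vectors of L²(μ) -/

lemma coeFn_expVec (s : ℝ) : expVec s =ᵐ[cantorMeasure] expFun s :=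
  MemLp.coeFn_toLp _

lemma inner_expVec (s t : ℝ) : inner ℂ (expVec s) (expVec t) = hat (t - s) := by
  rw [L2.inner_def, hat]
  refine integral_congr_ae ?_
  filter_upwards [coeFn_expVec s, coeFn_expVec t] with x hs ht
  rw [hs, ht, RCLike.inner_apply, ← expFun_neg, ← expFun_add, sub_eq_add_neg]

lemma norm_expVec (s : ℝ) : ‖expVec s‖ = 1 := by
  have h : (inner ℂ (expVec s) (expVec s)).re = 1 := by
    rw [inner_expVec, sub_self, hat_zero, Complex.one_re]
  have h' : ‖expVec s‖ ^ 2 = 1 := by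
    rw [← h]
    exact norm_sq_eq_re_inner (𝕜 := ℂ) (expVec s)
  exact (pow_eq_one_iff_of_nonneg (norm_nonneg _) two_ne_zero).1 h'

lemma continuous_hat : Continuous hat := by
  have h : hat = fun s => charFun cantorMeasure (2 * Real.pi * s) := by
    funext s
    rw [charFun_apply_real, hat]
    congr 1 with x
    rw [expFun]
    congr 1
    push_cast
    ring
  rw [h]
  exact continuous_charFun.comp (by fun_prop)

lemma continuous_expVec : Continuous expVec := by
  rw [continuous_iff_continuousAt]
  intro s
  rw [ContinuousAt, tendsto_iff_norm_sub_tendsto_zero]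
  have h : ∀ t, ‖expVec t - expVec s‖ = Real.sqrt (2 - 2 * (hat (s - t)).re) := by
    intro t
    have := @norm_sub_sq ℂ _ _ _ _ (expVec t) (expVec s)
    rw [norm_expVec, norm_expVec, inner_expVec] at this
    rw [← Real.sqrt_sq (norm_nonneg (expVec t - expVec s)), this]
    congr 1
    simp
    ring
  simp only [h]
  have hc : Continuous fun t => Real.sqrt (2 - 2 * (hat (s - t)).re) := by
    have := continuous_hat
    fun_prop
  have := hc.tendsto s
  simpa [hat_zero] using this

/-- A vector of `L²(μ)` orthogonal to all exponentials vanishes. -/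
lemma eq_zero_of_inner_expVec (f : Lp ℂ 2 cantorMeasure)
    (hf : ∀ s, inner ℂ (expVec s) f = 0) : f = 0 := by
  have hint : Integrable f cantorMeasure := (Lp.memLp f).integrable (by norm_num)
  have hF : ∀ s, ∫ x, expFun s x * f x ∂cantorMeasure = 0 := by
    intro s
    rw [← hf (-s), L2.inner_def]
    refine integral_congr_ae ?_
    filter_upwards [coeFn_expVec (-s)] with x hs
    rw [hs, RCLike.inner_apply, ← expFun_neg, neg_neg, mul_comm]
  have hmul : ∀ (g : ℝ → ℂ), Integrable g cantorMeasure → ∀ s,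
      Integrable (fun x => expFun s x * g x) cantorMeasure := fun g hg s =>
    hg.bdd_mul (continuous_expFun s).aestronglyMeasurable
      (Filter.Eventually.of_forall fun x => (norm_expFun s x).le)
  have hFc : ∀ s, ∫ x, expFun s x * (starRingEnd ℂ) (f x) ∂cantorMeasure = 0 := by
    intro s
    have h := congrArg (starRingEnd ℂ) (hF (-s))
    rw [← integral_conj, map_zero] at h
    rw [← h]
    congr 1 with x
    rw [map_mul, ← expFun_neg, neg_neg]
  have hconj : Integrable (fun x => (starRingEnd ℂ) (f x)) cantorMeasure := by
    exact (RCLike.conjCLE (K := ℂ)).toContinuousLinearMap.integrable_comp hint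
  have hreal : ∀ g : ℝ → ℝ, Integrable g cantorMeasure →
      (∀ s, ∫ x, expFun s x * (g x : ℂ) ∂cantorMeasure = 0) → g =ᵐ[cantorMeasure] 0 := by
    intro g hg h0
    have hneg : Integrable (fun x => -g x) cantorMeasure := hg.neg
    -- `ENNReal.ofReal` truncates at 0, so the densities of `g` and `-g` are the positive and
    -- negative parts of `g`. Both are finite measures, and their characteristic functions differ by
    -- the transform of `g`, which vanishes.
    have key : ∀ k : ℝ → ℝ, Integrable k cantorMeasure → ∀ t,
        charFun (cantorMeasure.withDensity fun x => ENNReal.ofReal (k x)) t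
          = ∫ x, expFun (t / (2 * Real.pi)) x * ((max (k x) 0 : ℝ) : ℂ) ∂cantorMeasure := by
      intro k hk t
      rw [charFun_apply_real, integral_withDensity_eq_integral_toReal_smul₀
        hk.aemeasurable.ennreal_ofReal (by simp)]
      congr 1 with x
      have hpi : (Real.pi : ℂ) ≠ 0 := by exact_mod_cast Real.pi_ne_zero
      rw [ENNReal.toReal_ofReal', Complex.real_smul, mul_comm, expFun]
      congr 2
      push_cast
      field_simp
    have := isFiniteMeasure_withDensity_ofReal hg.2
    have := isFiniteMeasure_withDensity_ofReal hneg.2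
    have heq : cantorMeasure.withDensity (fun x => ENNReal.ofReal (g x))
        = cantorMeasure.withDensity (fun x => ENNReal.ofReal (-g x)) := by
      refine Measure.ext_of_charFun (funext fun t => ?_)
      have h1 : Integrable (fun x => ((max (g x) 0 : ℝ) : ℂ)) cantorMeasure :=
        hg.pos_part.ofReal
      have h2 : Integrable (fun x => ((max (-g x) 0 : ℝ) : ℂ)) cantorMeasure :=
        hneg.pos_part.ofReal
      rw [key g hg, key _ hneg, ← sub_eq_zero, ← integral_sub (hmul _ h1 _) (hmul _ h2 _),
        ← h0 (t / (2 * Real.pi))]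
      congr 1 with x
      rw [← mul_sub, ← Complex.ofReal_sub]
      congr 2
      rcases le_total (g x) 0 with h | h
      · rw [max_eq_right h, max_eq_left (by linarith)]; ring
      · rw [max_eq_left h, max_eq_right (by linarith)]; ring
    have hae := (withDensity_eq_iff_of_sigmaFinite hg.aemeasurable.ennreal_ofReal
      hneg.aemeasurable.ennreal_ofReal).1 heq
    filter_upwards [hae] with x hx
    have hx' := congrArg ENNReal.toReal hx
    rw [ENNReal.toReal_ofReal', ENNReal.toReal_ofReal'] at hx'
    rcases le_total (g x) 0 with h | h
    · rw [max_eq_right h, max_eq_left (by linarith)] at hx'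
      simp only [Pi.zero_apply]; linarith
    · rw [max_eq_left h, max_eq_right (by linarith)] at hx'
      simp only [Pi.zero_apply]; linarith
  -- The transform of the conjugate of f also vanishes (`hFc`), hence so do those of its real and
  -- imaginary parts.
  have hre := hreal (fun x => (f x).re) hint.re (by
    intro s
    have h := integral_add (hmul _ hint s) (hmul _ hconj s)
    rw [hF, hFc, add_zero] at h
    have h2 : ∀ x, expFun s x * ((f x).re : ℂ)
        = 2⁻¹ * (expFun s x * f x + expFun s x * (starRingEnd ℂ) (f x)) := by
      intro x
      rw [← mul_add, Complex.add_conj]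
      push_cast
      ring
    simp only [h2]
    rw [integral_const_mul, h, mul_zero])
  have him := hreal (fun x => (f x).im) hint.im (by
    intro s
    have h := integral_sub (hmul _ hint s) (hmul _ hconj s)
    rw [hF, hFc, sub_zero] at h
    have h2 : ∀ x, expFun s x * ((f x).im : ℂ)
        = (2 * Complex.I)⁻¹ * (expFun s x * f x - expFun s x * (starRingEnd ℂ) (f x)) := by
      intro x
      rw [← mul_sub, Complex.sub_conj]
      have := Complex.I_ne_zero
      push_cast
      field_simp
    simp only [h2]
    rw [integral_const_mul, h, mul_zero])
  refine (Lp.eq_zero_iff_ae_eq_zero).2 ?_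
  filter_upwards [hre, him] with x h1 h2
  exact Complex.ext h1 h2

/-! ### Integer cycles -/

/-- An integer cycle, other than the fixed point `0`, of the maps `x ↦ x / 4`,
`x ↦ (x + m) / 4`. -/
def HasCycle (m : ℕ) : Prop :=
  ∃ (x : ℕ → ℤ) (p : ℕ), 0 < p ∧ (∀ i, x (i + p) = x i) ∧
    (∀ i, 4 * x (i + 1) = x i ∨ 4 * x (i + 1) = x i + m) ∧ x 0 ≠ 0

lemma iterate_le {f : ℕ → ℤ} (h : ∀ i, 4 * f (i + 1) ≤ f i) (i p : ℕ) :
    4 ^ p * f (i + p) ≤ f i := by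
  induction p with
  | zero => simp
  | succ p ih =>
    have h1 := h (i + p)
    have h2 : (0 : ℤ) < 4 ^ p := by positivity
    calc (4 : ℤ) ^ (p + 1) * f (i + (p + 1)) = 4 ^ p * (4 * f (i + p + 1)) := by
          rw [pow_succ, mul_assoc, add_assoc]
      _ ≤ 4 ^ p * f (i + p) := by gcongr
      _ ≤ f i := ih

/-- Once round the period gives 4^p f(i) ≤ f(i). Applied to -x and to 3x - m, this confines a cycle
to the interval from 0 to m/3. -/
lemma nonpos_of_periodic {f : ℕ → ℤ} (h : ∀ i, 4 * f (i + 1) ≤ f i) {p : ℕ} (hp : 0 < p)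
    (hper : ∀ i, f (i + p) = f i) (i : ℕ) : f i ≤ 0 := by
  have h1 := iterate_le h i p
  rw [hper] at h1
  have h2 : (1 : ℤ) < 4 ^ p := one_lt_pow₀ (by norm_num) hp.ne'
  by_contra! h3
  nlinarith

lemma cycle_pos {m : ℕ} {x : ℕ → ℤ} {p : ℕ} (hp : 0 < p) (hper : ∀ i, x (i + p) = x i)
    (hx : ∀ i, 4 * x (i + 1) = x i ∨ 4 * x (i + 1) = x i + m) (h0 : x 0 ≠ 0) (i : ℕ) :
    0 < x i := by
  have hneg := nonpos_of_periodic (f := fun i => - x i)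
    (fun i => by rcases hx i with h | h <;> lia) hp (fun i => by rw [hper])
  induction i with
  | zero => have := hneg 0; lia
  | succ i ih => rcases hx i with h | h <;> omega

lemma cycle_le {m : ℕ} {x : ℕ → ℤ} {p : ℕ} (hp : 0 < p) (hper : ∀ i, x (i + p) = x i)
    (hx : ∀ i, 4 * x (i + 1) = x i ∨ 4 * x (i + 1) = x i + m) (i : ℕ) :
    3 * x i ≤ m := by
  have h := nonpos_of_periodic (f := fun i => 3 * x i - m)
    (fun i => by rcases hx i with h | h <;> lia) hp
    (fun i => by rw [hper]) i
  lia

lemma four_pow_mul_modEq {m : ℕ} {x : ℕ → ℤ}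
    (hx : ∀ i, 4 * x (i + 1) = x i ∨ 4 * x (i + 1) = x i + m) (i : ℕ) :
    (4 : ZMod m) ^ i * (x i : ZMod m) = (x 0 : ZMod m) := by
  induction i with
  | zero => simp
  | succ i ih =>
    rw [← ih, pow_succ, mul_assoc]
    congr 1
    rcases hx i with h | h <;> have := congrArg (Int.cast : ℤ → ZMod m) h <;> simpa using this

lemma isUnit_four {m : ℕ} (hm : Odd m) : IsUnit (4 : ZMod m) := by
  have h : Nat.Coprime 4 m := by
    exact (Nat.coprime_two_left.2 hm).pow_left 2
  exact_mod_cast (ZMod.isUnit_iff_coprime 4 m).2 h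

lemma isCoprime_four {m : ℕ} (hm : Odd m) : IsCoprime (m : ℤ) 4 :=
  Nat.isCoprime_iff_coprime.2 ((Nat.coprime_two_left.2 hm).pow_left 2).symm

/-- Each block of four consecutive integers contributes two; the incomplete block contributes at
most min(K % 4, 2). -/
lemma card_filter_adjacent_mod_four (u K : ℕ) :
    ((Finset.range K).filter fun k => k % 4 = u % 4 ∨ k % 4 = (u + 1) % 4).card
      ≤ 2 * (K / 4) + min (K % 4) 2 := by
  induction K using Nat.strong_induction_on with
  | _ K ih =>
    rcases lt_or_ge K 4 with hK | hK
    · have hu : u % 4 < 4 := Nat.mod_lt _ (by norm_num)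
      have h1 : (u + 1) % 4 = (u % 4 + 1) % 4 := by omega
      rw [h1]
      generalize u % 4 = v at *
      interval_cases K <;> interval_cases v <;> decide
    · obtain ⟨L, rfl⟩ := Nat.exists_eq_add_of_le' hK
      have h := ih L (by omega)
      have h4 : (L + 4) / 4 = L / 4 + 1 := by omega
      have h5 : (L + 4) % 4 = L % 4 := by omega
      rw [h4, h5]
      simp only [Finset.range_add_one, Finset.filter_insert]
      split_ifs <;> first
        | omega
        | (refine (Finset.card_insert_le _ _).trans ?_
           first
            | omega
            | (have := Finset.card_insert_le (L + 2)
                ((Finset.range L).filter fun k => k % 4 = u % 4 ∨ k % 4 = (u + 1) % 4)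
               have := Finset.card_insert_le (L + 1)
                ((Finset.range L).filter fun k => k % 4 = u % 4 ∨ k % 4 = (u + 1) % 4)
               have := Finset.card_insert_le (L)
                ((Finset.range L).filter fun k => k % 4 = u % 4 ∨ k % 4 = (u + 1) % 4)
               omega))

/-! ### Enumeration of Γ(m) and orthonormality -/

/-- The element of `Γ(m)` whose digits are the binary digits of `n` multiplied by `m`. -/
def gam (m n : ℕ) : ℤ :=
  if n = 0 then 0 else 4 * gam m (n / 2) + (n % 2 : ℕ) * m
  termination_by n
  decreasing_by omega

lemma gam_zero (m : ℕ) : gam m 0 = 0 := by rw [gam, if_pos rfl]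

lemma gam_rec (m n : ℕ) : gam m n = 4 * gam m (n / 2) + (n % 2 : ℕ) * m := by
  rcases eq_or_ne n 0 with rfl | h
  · simp [gam_zero]
  · rw [gam, if_neg h]

lemma gam_two_mul (m n : ℕ) : gam m (2 * n) = 4 * gam m n := by
  rw [gam_rec]
  have h1 : 2 * n / 2 = n := by omega
  have h2 : 2 * n % 2 = 0 := by omega
  simp [h1, h2]

lemma gam_two_mul_add_one (m n : ℕ) : gam m (2 * n + 1) = 4 * gam m n + m := by
  rw [gam_rec]
  have h1 : (2 * n + 1) / 2 = n := by omega
  have h2 : (2 * n + 1) % 2 = 1 := by omega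
  simp [h1, h2]

lemma Gam_eq_range (m : ℕ) : Gam m = Set.range fun n => (gam m n : ℝ) := by
  ext x
  constructor
  · rintro ⟨n, l, hl, rfl⟩
    induction n generalizing l with
    | zero =>
      rcases hl 0 with h | h
      · exact ⟨0, by simp [h, gam_zero]⟩
      · exact ⟨2 * 0 + 1, by simp only [gam_two_mul_add_one]; simp [h, gam_zero]⟩
    | succ n ih =>
      obtain ⟨k, hk⟩ := ih (fun k => l (k + 1)) (fun k => hl (k + 1))
      have e : ∑ k ∈ Finset.range (n + 1 + 1), 4 ^ k * l k = 4 * (gam m k : ℝ) + l 0 := by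
        simp only at hk
        rw [Finset.sum_range_succ', hk, Finset.mul_sum]
        simp only [pow_succ, pow_zero, one_mul, add_left_inj]
        exact Finset.sum_congr rfl fun _ _ => by ring
      rcases hl 0 with h | h
      · exact ⟨2 * k, by rw [e, h]; simp only [gam_two_mul]; push_cast; ring⟩
      · exact ⟨2 * k + 1, by rw [e, h]; simp only [gam_two_mul_add_one]; push_cast; ring⟩
  · rintro ⟨n, rfl⟩
    induction n using Nat.strong_induction_on with
    | _ n ih =>
      rcases eq_or_ne n 0 with rfl | hn
      · exact ⟨0, fun _ => 0, fun _ => Or.inl rfl, by simp [gam_zero]⟩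
      · obtain ⟨N, l, hl, hs⟩ := ih (n / 2) (by omega)
        refine ⟨N + 1, fun k => Nat.casesOn k ((n % 2 : ℕ) * m : ℝ) l, fun k => ?_, ?_⟩
        · cases k with
          | zero =>
            rcases Nat.mod_two_eq_zero_or_one n with h | h
            · left; simp [h]
            · right; simp [h]
          | succ k => exact hl k
        · rw [Finset.sum_range_succ']
          simp only at hs ⊢
          rw [gam_rec]
          rw [Int.cast_add, Int.cast_mul, hs, Int.cast_ofNat, Finset.mul_sum]
          congr 1
          · exact Finset.sum_congr rfl fun _ _ => by ring
          · rw [Int.cast_mul, Int.cast_natCast, Int.cast_natCast, pow_zero, one_mul]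
            rfl

/-- Strip equal lowest digits, each removing a factor 4; at the first differing digit the difference
is odd because m is odd. -/
lemma hat_gam_sub {m : ℕ} (hm : Odd m) {n k : ℕ} (h : n ≠ k) :
    hat ((gam m n - gam m k : ℤ) : ℝ) = 0 := by
  induction hN : n + k using Nat.strong_induction_on generalizing n k with
  | _ N ih =>
    have hmz : Odd (m : ℤ) := by exact_mod_cast hm
    rw [gam_rec m n, gam_rec m k]
    by_cases hp : n % 2 = k % 2
    · have h2 : n / 2 ≠ k / 2 := by omega
      rw [hp, add_sub_add_right_eq_sub, ← mul_sub]
      exact hat_four_mul (ih (n / 2 + k / 2) (by omega) h2 rfl)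
    · apply hat_odd
      rcases Nat.mod_two_eq_zero_or_one n with h1 | h1 <;>
      rcases Nat.mod_two_eq_zero_or_one k with h2 | h2
      · omega
      · rw [h1, h2]; push_cast; grind
      · rw [h1, h2]; push_cast; grind
      · omega

lemma orthonormal_expVec_gam {m : ℕ} (hm : Odd m) :
    Orthonormal ℂ fun n => expVec (gam m n) := by
  refine ⟨fun n => norm_expVec _, fun n k h => ?_⟩
  simp only [inner_expVec]
  exact_mod_cast hat_gam_sub hm (Ne.symm h)

lemma orthonormal_expVec_Gam {m : ℕ} (hm : Odd m) :
    Orthonormal ℂ fun lam : Gam m => expVec lam := by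
  refine ⟨fun n => norm_expVec _, ?_⟩
  rintro ⟨x, hx⟩ ⟨y, hy⟩ h
  rw [Gam_eq_range] at hx hy
  obtain ⟨n, rfl⟩ := hx
  obtain ⟨k, rfl⟩ := hy
  exact (orthonormal_expVec_gam hm).2 (fun hnk => h (by simp [hnk]))

lemma range_expVec_Gam (m : ℕ) :
    Set.range (fun lam : Gam m => expVec lam) = Set.range fun n => expVec (gam m n) := by
  rw [← Set.image_eq_range, Gam_eq_range, ← Set.range_comp]
  rfl

/-! ### Parseval's identity on a closed span -/

section Parseval

variable {E : Type*} [NormedAddCommGroup E] [InnerProductSpace ℂ E] [CompleteSpace E]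

/-- Parseval's identity for the projection on the closed span of an orthonormal family. -/
lemma hasSum_norm_inner_sq {v : ℕ → E} (hv : Orthonormal ℂ v) (x : E) :
    HasSum (fun n => ‖inner ℂ (v n) x‖ ^ 2)
      (‖(Submodule.span ℂ (Set.range v)).topologicalClosure.starProjection x‖ ^ 2) := by
  set V := (Submodule.span ℂ (Set.range v)).topologicalClosure with hV
  have hmem : ∀ n, v n ∈ V := fun n =>
    Submodule.le_topologicalClosure _ (Submodule.subset_span ⟨n, rfl⟩)
  let w : ℕ → V := fun n => ⟨v n, hmem n⟩
  have hw : Orthonormal ℂ w := ⟨fun n => hv.1 n, fun i j h => hv.2 h⟩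
  have himg : V.subtype '' (Submodule.span ℂ (Set.range w) : Set V)
      = (Submodule.span ℂ (Set.range v) : Set E) := by
    rw [← Submodule.map_coe, Submodule.map_span, ← Set.range_comp]
    rfl
  have hsp : ⊤ ≤ (Submodule.span ℂ (Set.range w)).topologicalClosure := by
    rintro ⟨y, hy⟩ -
    rw [← SetLike.mem_coe, Submodule.topologicalClosure_coe, closure_subtype]
    change y ∈ closure (V.subtype '' _)
    rw [himg, ← Submodule.topologicalClosure_coe]
    exact hy
  let b := HilbertBasis.mk hw hsp
  have h := b.hasSum_inner_mul_inner (V.orthogonalProjectionOnto x) (V.orthogonalProjectionOnto x)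
  have hb : ∀ n, b n = w n := fun n => by rw [HilbertBasis.coe_mk]
  have h1 : ∀ n, inner ℂ (w n) (V.orthogonalProjectionOnto x) = inner ℂ (v n) x := by
    intro n
    rw [Submodule.inner_orthogonalProjectionOnto_eq_of_mem_left]
  have h2 : ∀ n, inner ℂ (V.orthogonalProjectionOnto x) (b n)
      * inner ℂ (b n) (V.orthogonalProjectionOnto x) = ((‖inner ℂ (v n) x‖ ^ 2 : ℝ) : ℂ) := by
    intro n
    rw [hb, ← inner_conj_symm, h1, Complex.conj_mul']
    push_cast
    rfl
  simp only [h2, inner_self_eq_norm_sq_to_K] at h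
  have h3 := Complex.hasSum_re h
  simpa [← Complex.ofReal_pow] using h3

end Parseval

/-! ### Without a cycle, m is complete -/

lemma cos_sq_ne_zero {t : ℝ} (ht : ∀ n : ℤ, t ≠ n) : 0 < Real.cos (Real.pi * t / 2) ^ 2 := by
  refine sq_pos_of_ne_zero (fun h => ?_)
  obtain ⟨k, hk⟩ := Real.cos_eq_zero_iff.1 h
  apply ht (2 * k + 1)
  have := Real.pi_pos
  push_cast
  field_simp at hk
  linarith

/-- A nonnegative continuous solution of the transfer equation which vanishes at `0` is zero,
unless there is a nonzero integer cycle. -/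
lemma eq_zero_of_transfer {m : ℕ} (hc : ¬ HasCycle m) {h : ℝ → ℝ}
    (hcont : Continuous h) (hnn : ∀ t, 0 ≤ h t) (h0 : h 0 = 0)
    (heq : ∀ t, h t = Real.cos (Real.pi * t / 2) ^ 2 * h (t / 4)
      + Real.sin (Real.pi * t / 2) ^ 2 * h ((t + m) / 4)) (t : ℝ) : h t = 0 := by
  -- With R ≥ m both maps preserve [-R, R], so the maximum over this interval can be propagated.
  set R : ℝ := max |t| m with hR
  have hRt : |t| ≤ R := le_max_left _ _
  have hRm : (m : ℝ) ≤ R := le_max_right _ _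
  have hm0 : (0 : ℝ) ≤ m := Nat.cast_nonneg m
  obtain ⟨t₀, ht₀, hmax⟩ := (isCompact_Icc (a := -R) (b := R)).exists_isMaxOn
    ⟨t, abs_le.1 hRt⟩ hcont.continuousOn
  have hle : ∀ s, s ∈ Set.Icc (-R) R → h s ≤ h t₀ := fun s hs => hmax hs
  by_contra hne
  have hM : 0 < h t₀ := lt_of_lt_of_le (lt_of_le_of_ne (hnn t) (Ne.symm hne))
    (hle t (abs_le.1 hRt))
  let Z : ℝ → Prop := fun s => s ∈ Set.Icc (-R) R ∧ h s = h t₀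
  have hI0 : ∀ s, s ∈ Set.Icc (-R) R → s / 4 ∈ Set.Icc (-R) R := fun s hs =>
    ⟨by linarith [hs.1], by linarith [hs.2]⟩
  have hI1 : ∀ s, s ∈ Set.Icc (-R) R → (s + m) / 4 ∈ Set.Icc (-R) R := fun s hs =>
    ⟨by linarith [hs.1], by linarith [hs.2]⟩
  -- The equation is a convex combination: at a maximum point, every branch of positive weight again
  -- attains the maximum.
  have hZ0 : ∀ s, Z s → 0 < Real.cos (Real.pi * s / 2) ^ 2 → Z (s / 4) := by
    rintro s ⟨hs, hs'⟩ hp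
    refine ⟨hI0 s hs, ?_⟩
    have e := heq s
    have a0 := hle _ (hI0 s hs)
    have a1 := hle _ (hI1 s hs)
    have := Real.sin_sq_add_cos_sq (Real.pi * s / 2)
    by_contra hlt
    have hlt' := lt_of_le_of_ne a0 hlt
    nlinarith [sq_nonneg (Real.sin (Real.pi * s / 2)), mul_lt_mul_of_pos_left hlt' hp,
      mul_le_mul_of_nonneg_left a1 (sq_nonneg (Real.sin (Real.pi * s / 2)))]
  have hZ1 : ∀ s, Z s → 0 < Real.sin (Real.pi * s / 2) ^ 2 → Z ((s + m) / 4) := by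
    rintro s ⟨hs, hs'⟩ hp
    refine ⟨hI1 s hs, ?_⟩
    have e := heq s
    have a0 := hle _ (hI0 s hs)
    have a1 := hle _ (hI1 s hs)
    have := Real.sin_sq_add_cos_sq (Real.pi * s / 2)
    by_contra hlt
    have hlt' := lt_of_le_of_ne a1 hlt
    nlinarith [sq_nonneg (Real.cos (Real.pi * s / 2)), mul_lt_mul_of_pos_left hlt' hp,
      mul_le_mul_of_nonneg_left a0 (sq_nonneg (Real.cos (Real.pi * s / 2)))]
  -- From a non-integer maximum point, repeated division by 4 never meets an integer, so the maximum
  -- value is carried along to the limit 0, where `h` vanishes.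
  have hint : ∀ s, Z s → ∃ n : ℤ, s = n := by
    intro s hs
    by_contra! hn
    have hall : ∀ k : ℕ, Z (s * (1 / 4) ^ k) ∧ ∀ n : ℤ, s * (1 / 4) ^ k ≠ n := by
      intro k
      induction k with
      | zero => simpa using ⟨hs, hn⟩
      | succ k ih =>
        have e : s * (1 / 4) ^ (k + 1) = s * (1 / 4) ^ k / 4 := by ring
        rw [e]
        refine ⟨hZ0 _ ih.1 (cos_sq_ne_zero ih.2), fun n hn => ih.2 (4 * n) ?_⟩
        push_cast
        linarith
    have hlim : Filter.Tendsto (fun n : ℕ => s * (1 / 4 : ℝ) ^ n) Filter.atTop (nhds 0) := by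
      simpa using (tendsto_pow_atTop_nhds_zero_of_lt_one (r := (1 / 4 : ℝ)) (by norm_num)
        (by norm_num)).const_mul s
    have hl := (hcont.tendsto 0).comp hlim
    have hl' : Filter.Tendsto (fun _ : ℕ => h t₀) Filter.atTop (nhds (h 0)) :=
      hl.congr fun k => (hall k).1.2
    have := tendsto_nhds_unique hl' tendsto_const_nhds
    linarith
  have hnext : ∀ z : {z : ℤ // Z z}, ∃ z' : {z : ℤ // Z z},
      4 * (z' : ℤ) = z ∨ 4 * (z' : ℤ) = z + m := by
    rintro ⟨z, hz⟩
    have hr : Z (z / 4) ∨ Z ((z + m) / 4) := by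
      rcases Int.even_or_odd z with he | ho
      · left
        apply hZ0 _ hz
        have := cos_sq_even he 0
        rw [zero_add, mul_zero, zero_div, Real.cos_zero, one_pow] at this
        rw [this]
        exact one_pos
      · right
        apply hZ1 _ hz
        have := cos_sq_odd ho 0
        have h2 := Real.sin_sq_add_cos_sq (Real.pi * z / 2)
        rw [zero_add, mul_zero, zero_div, Real.sin_zero] at this
        nlinarith
    rcases hr with hr | hr <;> obtain ⟨n, hn⟩ := hint _ hr <;> rw [hn] at hr
    · refine ⟨⟨n, hr⟩, Or.inl ?_⟩
      have : (4 * n : ℝ) = z := by rw [← hn]; ring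
      exact_mod_cast this
    · refine ⟨⟨n, hr⟩, Or.inr ?_⟩
      have : (4 * n : ℝ) = z + m := by rw [← hn]; ring
      exact_mod_cast this
  choose next hnx using hnext
  obtain ⟨z₀, rfl⟩ := hint t₀ ⟨ht₀, rfl⟩
  let x : ℕ → {z : ℤ // Z z} := fun i => next^[i] ⟨z₀, ht₀, rfl⟩
  -- The orbit of maximum points is a sequence in a finite set of integers, so it repeats; it avoids
  -- 0 because `h 0 = 0`.
  have hfin : Finite {z : ℤ // Z z} := by
    refine Set.Finite.subset (Set.finite_Icc (-⌈R⌉) ⌈R⌉) ?_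
    rintro z ⟨⟨h1, h2⟩, -⟩
    have := Int.le_ceil R
    constructor
    · have : (-⌈R⌉ : ℝ) ≤ z := by linarith
      exact_mod_cast this
    · have : (z : ℝ) ≤ ⌈R⌉ := by linarith
      exact_mod_cast this
  obtain ⟨i, j, hij, hxe⟩ : ∃ i j, i < j ∧ x i = x j := by
    obtain ⟨i, j, hij, hxe⟩ := Finite.exists_ne_map_eq_of_infinite x
    rcases lt_or_gt_of_ne hij with h | h
    · exact ⟨i, j, h, hxe⟩
    · exact ⟨j, i, h, hxe.symm⟩
  apply hc
  refine ⟨fun k => x (k + i), j - i, by omega, fun k => ?_, fun k => ?_, fun hz => ?_⟩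
  · have e : k + (j - i) + i = k + j := by omega
    simp only [e, x, Function.iterate_add_apply]
    simp only [x] at hxe
    rw [hxe]
  · have e : k + 1 + i = (k + i) + 1 := by omega
    simp only [e, x, Function.iterate_succ_apply']
    exact hnx _
  · simp only [zero_add] at hz
    have := (x i).2.2
    rw [hz, Int.cast_zero, h0] at this
    linarith

theorem isComplete_of_not_hasCycle {m : ℕ} (hm : Odd m) (hc : ¬ HasCycle m) : IsComplete m := by
  refine ⟨orthonormal_expVec_Gam hm, ?_⟩
  rw [range_expVec_Gam]
  have hv := orthonormal_expVec_gam hm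
  set v : ℕ → Lp ℂ 2 cantorMeasure := fun n => expVec (gam m n) with hvdef
  set V := (Submodule.span ℂ (Set.range v)).topologicalClosure with hV
  have hsum : ∀ t, HasSum (fun n => ‖hat (t + gam m n)‖ ^ 2)
      (‖V.starProjection (expVec (-t))‖ ^ 2) := by
    intro t
    have h := hasSum_norm_inner_sq hv (expVec (-t))
    convert h using 3 with n
    rw [inner_expVec, ← neg_add', hat_neg, RCLike.norm_conj]
  set Q : ℝ → ℝ := fun t => ‖V.starProjection (expVec (-t))‖ ^ 2 with hQ
  have hQeq : ∀ t, Q t = Real.cos (Real.pi * t / 2) ^ 2 * Q (t / 4)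
      + Real.sin (Real.pi * t / 2) ^ 2 * Q ((t + m) / 4) := by
    intro t
    have h0 := (hsum (t / 4)).mul_left (Real.cos (Real.pi * t / 2) ^ 2)
    have h1 := (hsum ((t + m) / 4)).mul_left (Real.sin (Real.pi * t / 2) ^ 2)
    -- Even and odd indices are the frequencies with lowest digit 0 and m; the odd shift turns cos²
    -- into sin².
    refine (hsum t).unique (HasSum.even_add_odd ?_ ?_)
    · refine (congrArg (HasSum · _) (funext fun n => ?_)).mp h0
      symm
      rw [gam_two_mul, norm_hat_sq, cos_sq_even ⟨2 * gam m n, by ring⟩]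
      congr 4
      push_cast
      ring
    · refine (congrArg (HasSum · _) (funext fun n => ?_)).mp h1
      have ho : Odd (4 * gam m n + m) := by
        have : Odd (m : ℤ) := by exact_mod_cast hm
        grind
      symm
      rw [gam_two_mul_add_one, norm_hat_sq, cos_sq_odd ho]
      congr 4
      push_cast
      ring
  have hQle : ∀ t, Q t ≤ 1 := fun t => by
    have h := V.norm_starProjection_apply_le (expVec (-t))
    rw [norm_expVec] at h
    exact pow_le_one₀ (norm_nonneg _) h
  have hmem : ∀ t, Q t = 1 ↔ expVec (-t) ∈ V := fun t => by
    rw [Submodule.mem_iff_norm_starProjection, norm_expVec, hQ]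
    exact pow_eq_one_iff_of_nonneg (norm_nonneg _) two_ne_zero
  have hz : ∀ t, 1 - Q t = 0 := by
    refine eq_zero_of_transfer hc ?_ (fun t => sub_nonneg.2 (hQle t)) ?_ (fun t => ?_)
    · have := continuous_expVec
      fun_prop
    · rw [sub_eq_zero, eq_comm, hmem]
      refine Submodule.le_topologicalClosure _ (Submodule.subset_span ⟨0, ?_⟩)
      simp [v, gam_zero]
    · have := Real.sin_sq_add_cos_sq (Real.pi * t / 2)
      linear_combination - hQeq t - this
  -- Q = 1 puts every exponential, not only those with frequency in Γ(m), into `V`.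
  have hall : ∀ t, expVec t ∈ V := fun t => by
    have := (hmem (-t)).1 (by linarith [hz (-t)])
    rwa [neg_neg] at this
  have hVc : IsClosed (V : Set (Lp ℂ 2 cantorMeasure)) := Submodule.isClosed_topologicalClosure _
  rw [← Submodule.orthogonal_eq_bot_iff, Submodule.eq_bot_iff]
  intro f hf
  exact eq_zero_of_inner_expVec f fun s => hf _ (hall s)

/-! ### With a cycle, m is incomplete -/

lemma gam_nonneg (m n : ℕ) : 0 ≤ gam m n := by
  induction n using Nat.strong_induction_on with
  | _ n ih =>
    rcases eq_or_ne n 0 with rfl | h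
    · rw [gam_zero]
    · have := ih (n / 2) (by omega)
      rw [gam_rec]
      positivity

/-- Descent on the positive integer x_i + γ: if the lowest digit of γ is the one used in the step
from x_i, the sum is four times a sum of the same kind; otherwise it is odd. -/
lemma hat_cycle_add_gam {m : ℕ} (hm : Odd m) {x : ℕ → ℤ} {p : ℕ} (hp : 0 < p)
    (hper : ∀ i, x (i + p) = x i)
    (hx : ∀ i, 4 * x (i + 1) = x i ∨ 4 * x (i + 1) = x i + m) (h0 : x 0 ≠ 0) (n i : ℕ) :
    hat ((x i + gam m n : ℤ) : ℝ) = 0 := by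
  have hpos : ∀ n i, 0 < x i + gam m n := fun n i =>
    add_pos_of_pos_of_nonneg (cycle_pos hp hper hx h0 i) (gam_nonneg m n)
  have hmz : Odd (m : ℤ) := by exact_mod_cast hm
  induction hN : (x i + gam m n).toNat using Nat.strong_induction_on generalizing n i with
  | _ N ih =>
    have hstep : x i + gam m n = 4 * (x (i + 1) + gam m (n / 2)) →
        hat ((x i + gam m n : ℤ) : ℝ) = 0 := by
      intro e
      rw [e]
      have h1 := hpos (n / 2) (i + 1)
      exact hat_four_mul (ih _ (by omega) (n / 2) (i + 1) rfl)
    have hr := gam_rec m n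
    rcases hx i with h | h <;> rcases Nat.mod_two_eq_zero_or_one n with h1 | h1 <;>
      rw [h1] at hr
    · apply hstep; push_cast at hr; linarith
    · apply hat_odd; rw [hr, ← h]; push_cast; grind
    · apply hat_odd; rw [hr]; push_cast; grind
    · apply hstep; push_cast at hr; linarith

theorem not_isComplete_of_hasCycle {m : ℕ} (hm : Odd m) (hc : HasCycle m) : ¬ IsComplete m := by
  rintro ⟨-, hd⟩
  obtain ⟨x, p, hp, hper, hx, h0⟩ := hc
  rw [range_expVec_Gam, Submodule.topologicalClosure_eq_top_iff, Submodule.eq_bot_iff] at hd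
  have h := hd (expVec (-(x 0 : ℝ))) (by
    rw [Submodule.mem_orthogonal]
    intro u hu
    induction hu using Submodule.span_induction with
    | mem u hu =>
      obtain ⟨n, rfl⟩ := hu
      have e : (-(x 0 : ℝ) - gam m n) = -((x 0 + gam m n : ℤ) : ℝ) := by push_cast; ring
      rw [inner_expVec, e, hat_neg, hat_cycle_add_gam hm hp hper hx h0, map_zero]
    | zero => exact inner_zero_left _
    | add u v _ _ hu hv => rw [inner_add_left, hu, hv, add_zero]
    | smul c u _ hu => rw [inner_smul_left, hu, mul_zero])
  have h1 := norm_expVec (-(x 0 : ℝ))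
  rw [h, norm_zero] at h1
  exact zero_ne_one h1

/-! ### Cycles of primitive numbers and the counting bound -/

/-- The gcd d of x_0 and m is odd, so it divides the whole cycle; the quotient is a cycle for m/d,
which is a proper divisor if d > 1. -/
lemma isCoprime_cycle_of_isPrimitive {m : ℕ} (hprim : IsPrimitive m) {x : ℕ → ℤ} {p : ℕ}
    (hp : 0 < p) (hper : ∀ i, x (i + p) = x i)
    (hx : ∀ i, 4 * x (i + 1) = x i ∨ 4 * x (i + 1) = x i + m) (h0 : x 0 ≠ 0) :
    IsCoprime (x 0) m := by
  obtain ⟨hm, -, hdiv⟩ := hprim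
  have hmpos := hm.pos
  rw [Int.isCoprime_iff_gcd_eq_one]
  set d := Int.gcd (x 0) m with hd
  have hdm : d ∣ m := by exact_mod_cast Int.gcd_dvd_right (x 0) m
  have hd0 : (d : ℤ) ∣ x 0 := Int.gcd_dvd_left _ _
  have hdpos : 0 < d := Nat.pos_of_dvd_of_pos hdm hmpos
  have hdodd : Odd d := hm.of_dvd_nat hdm
  have hdmz : (d : ℤ) ∣ m := by exact_mod_cast hdm
  have hall : ∀ i, (d : ℤ) ∣ x i := by
    intro i
    induction i with
    | zero => exact hd0
    | succ i ih =>
      have h4 : (d : ℤ) ∣ 4 * x (i + 1) := by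
        rcases hx i with h | h <;> rw [h]
        · exact ih
        · exact dvd_add ih hdmz
      exact (isCoprime_four hdodd).dvd_of_dvd_mul_left h4
  obtain ⟨e, he⟩ := hdm
  choose y hy using hall
  by_contra hne
  have hd0' : (d : ℤ) ≠ 0 := by exact_mod_cast hdpos.ne'
  have he0 : 0 < e := Nat.pos_of_ne_zero (fun h => by rw [h] at he; omega)
  have hedvd : e ∈ m.properDivisors := by
    rw [Nat.mem_properDivisors]
    refine ⟨⟨d, by rw [he, mul_comm]⟩, ?_⟩
    have : 2 ≤ d := by omega
    nlinarith
  refine not_isComplete_of_hasCycle (hm.of_dvd_nat ⟨d, by rw [he, mul_comm]⟩)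
    ⟨y, p, hp, fun i => ?_, fun i => ?_, fun h => h0 (by rw [hy, h, mul_zero])⟩ (hdiv e hedvd)
  · exact mul_left_cancel₀ hd0' (by rw [← hy, ← hy, hper])
  · have hmz : (m : ℤ) = d * e := by exact_mod_cast he
    have := hx i
    rw [hy, hy i, hmz, ← mul_add, mul_left_comm] at this
    exact this.imp (mul_left_cancel₀ hd0') (mul_left_cancel₀ hd0')

lemma o4_pos {m : ℕ} (hm : Odd m) : 0 < o4 m := by
  have : NeZero m := ⟨hm.pos.ne'⟩
  obtain ⟨u, hu⟩ := isUnit_four hm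
  rw [o4, ← hu, orderOf_units]
  exact orderOf_pos u

lemma o4_dvd {b m : ℕ} (h : b ∣ m) : o4 b ∣ o4 m := by
  have := orderOf_map_dvd (ZMod.castHom h (ZMod b)).toMonoidHom (4 : ZMod m)
  rwa [RingHom.toMonoidHom_eq_coe, MonoidHom.coe_coe, map_ofNat] at this

/-- At most `2 * (K / 4) + min (K % 4) 2` integers in `[0, b K)` lie in a given class modulo the
odd number `b` and are `0` or `-m` modulo `4`. -/
lemma card_le_of_modEq {b m r K : ℕ} (hb : Odd b) (hm : Odd m) {y : ℕ → ℤ}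
    (hinj : Set.InjOn y (Finset.range r)) {c : ℤ} (hc : ∀ j < r, (b : ℤ) ∣ y j - c)
    (hpos : ∀ j < r, 0 ≤ y j) (hlt : ∀ j < r, y j < b * K)
    (h4 : ∀ j < r, (4 : ℤ) ∣ y j ∨ (4 : ℤ) ∣ y j + m) :
    r ≤ 2 * (K / 4) + min (K % 4) 2 := by
  have hb0 : (0 : ℤ) < b := by exact_mod_cast hb.pos
  have hdm : ∀ j < r, y j = b * (y j / b) + c % b := by
    intro j hj
    rw [← Int.emod_eq_emod_iff_emod_sub_eq_zero.2 (Int.emod_eq_zero_of_dvd (hc j hj))]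
    exact (Int.mul_ediv_add_emod (y j) b).symm
  set f : ℕ → ℕ := fun j => (y j / b).toNat with hf
  have hfz : ∀ j < r, (f j : ℤ) = y j / b := fun j hj =>
    Int.toNat_of_nonneg (Int.ediv_nonneg (hpos j hj) hb0.le)
  have hfinj : Set.InjOn f (Finset.range r) := by
    intro i hi j hj hij
    have hi' := Finset.mem_range.1 hi
    have hj' := Finset.mem_range.1 hj
    apply hinj hi hj
    rw [hdm i hi', hdm j hj', ← hfz i hi', ← hfz j hj', hij]
  -- Write y = bf + e. Since b is its own inverse modulo 4, f is -be or -be - bm modulo 4, and bm is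
  -- odd, so the two classes are adjacent.
  obtain ⟨u, hu⟩ : ∃ u : ℕ, ∀ j < r, f j % 4 = u % 4 ∨ f j % 4 = (u + 1) % 4 := by
    obtain ⟨b', hb'⟩ := hb
    obtain ⟨m', hm'⟩ := hm
    set e := c % b with he
    have key : ∀ j < r, y j = 2 * (b' * f j : ℕ) + f j + e := by
      intro j hj
      rw [hdm j hj, ← hfz j hj, hb']
      push_cast
      ring
    have hpar : ∀ j < r, b' * f j % 2 = b' % 2 * (f j % 2) := by
      intro j _
      rcases Nat.mod_two_eq_zero_or_one b' with h1 | h1 <;>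
      rcases Nat.mod_two_eq_zero_or_one (f j) with h2 | h2 <;>
      simp [Nat.mul_mod, h1, h2]
    have hr : ∀ j < r, f j % 4 = (if b' % 2 = 0 then 4 - (e % 4).toNat else (e % 4).toNat) % 4 ∨
        f j % 4 = ((if b' % 2 = 0 then 4 - (e % 4).toNat else (e % 4).toNat)
          + (if (b' + m') % 2 = 0 then 3 else 1)) % 4 := by
      intro j hj
      have h1 := key j hj
      have h2 := hpar j hj
      have h3 := h4 j hj
      generalize b' * f j = z at *
      rcases Nat.mod_two_eq_zero_or_one b' with h5 | h5 <;>
      rcases Nat.mod_two_eq_zero_or_one m' with h6 | h6 <;>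
      rw [h5] at h2 <;> split_ifs <;> omega
    generalize (if b' % 2 = 0 then 4 - (e % 4).toNat else (e % 4).toNat) = s at hr
    split_ifs at hr
    -- The offset 3 is -1 modulo 4, so the lower class of the pair is s + 3.
    · exact ⟨s + 3, fun j hj => by have := hr j hj; omega⟩
    · exact ⟨s, hr⟩
  have hsub : (Finset.range r).image f
      ⊆ (Finset.range K).filter fun k => k % 4 = u % 4 ∨ k % 4 = (u + 1) % 4 := by
    intro k hk
    obtain ⟨j, hj, rfl⟩ := Finset.mem_image.1 hk
    rw [Finset.mem_range] at hj
    refine Finset.mem_filter.2 ⟨Finset.mem_range.2 ?_, hu j hj⟩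
    have : y j / b < K := Int.ediv_lt_of_lt_mul hb0 (by rw [mul_comm]; exact hlt j hj)
    rw [← hfz j hj] at this
    exact_mod_cast this
  calc r = ((Finset.range r).image f).card := by
        rw [Finset.card_image_of_injOn hfinj, Finset.card_range]
    _ ≤ _ := Finset.card_le_card hsub
    _ ≤ _ := card_filter_adjacent_mod_four u K

end CantorFour

end

/-! ### The main argument -/

theorem lemma3p6 (a b : ℕ) (ha : Odd a) (hb : Odd b)
    (h : (CantorFour.o4 (a * b) : ℝ) ≥ (2 * (a : ℝ) + 15) / 12 * (CantorFour.o4 b : ℝ)) :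
    ¬ CantorFour.IsPrimitive (a * b) := by
  open CantorFour in
  intro hprim
  have hm : Odd (a * b) := hprim.1
  obtain ⟨x, p, hp, hper, hx, h0⟩ : HasCycle (a * b) := by
    by_contra hc
    exact hprim.2.1 (isComplete_of_not_hasCycle hm hc)
  have hcop := isCoprime_cycle_of_isPrimitive hprim hp hper hx h0
  have hcop' : ∀ i, IsCoprime (x i) ((a * b : ℕ) : ℤ) := fun i =>
    isCoprime_cycle_of_isPrimitive hprim (x := fun k => x (i + k)) hp
      (fun k => by rw [← add_assoc, hper]) (fun k => hx (i + k))
      (cycle_pos hp hper hx h0 _).ne'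
  have hle := cycle_le hp hper hx
  have hpos := cycle_pos hp hper hx h0
  obtain ⟨r, hr⟩ := o4_dvd (dvd_mul_left b a)
  have hr12 : 2 * a + 15 ≤ 12 * r := by
    have hb0 : (0 : ℝ) < o4 b := by exact_mod_cast o4_pos hb
    rw [hr] at h
    push_cast at h
    have : (2 * (a : ℝ) + 15) / 12 ≤ r := by
      rw [mul_comm (o4 b : ℝ)] at h
      exact le_of_mul_le_mul_right h hb0
    have h2 : (2 * (a : ℝ) + 15) ≤ 12 * r := by linarith
    exact_mod_cast h2
  set y : ℕ → ℤ := fun j => x (o4 b * j) with hy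
  -- Cycle points are units modulo ab, so a repetition would force equal powers of 4 with distinct
  -- exponents below the order.
  have hinj : Set.InjOn y (Finset.range r) := by
    intro i hi j hj hij
    rw [Finset.coe_range, Set.mem_Iio] at hi hj
    have e := (four_pow_mul_modEq hx (o4 b * i)).trans (four_pow_mul_modEq hx (o4 b * j)).symm
    simp only [hy] at hij
    rw [hij] at e
    have hu : IsUnit (x (o4 b * j) : ZMod (a * b)) :=
      (ZMod.coe_int_isUnit_iff_isCoprime _ _).2 (hcop' _).symm
    have e' := hu.mul_right_cancel e
    have hlt : ∀ k < r, o4 b * k < orderOf (4 : ZMod (a * b)) := fun k hk => by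
      change _ < o4 (a * b)
      rw [hr]
      exact Nat.mul_lt_mul_of_pos_left hk (o4_pos hb)
    exact Nat.eq_of_mul_eq_mul_left (o4_pos hb) (pow_injOn_Iio_orderOf (hlt i hi) (hlt j hj) e')
  have hmod : ∀ j < r, (b : ℤ) ∣ y j - x 0 := by
    intro j _
    have e := congrArg (ZMod.castHom (dvd_mul_left b a) (ZMod b))
      (four_pow_mul_modEq hx (o4 b * j))
    have h1 : (4 : ZMod b) ^ o4 b = 1 := pow_orderOf_eq_one _
    rw [map_mul, map_pow, map_ofNat, map_intCast, map_intCast, pow_mul, h1, one_pow,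
      one_mul] at e
    rw [← Int.modEq_iff_dvd]
    exact ((ZMod.intCast_eq_intCast_iff _ _ _).1 e).symm
  have h4 : ∀ j < r, (4 : ℤ) ∣ y j ∨ (4 : ℤ) ∣ y j + (a * b : ℕ) := fun j _ =>
    (hx (o4 b * j)).imp (fun h => ⟨_, h.symm⟩) (fun h => ⟨_, h.symm⟩)
  -- Equality in the bound m/3 makes x_i a divisor of m coprime to m, so x_i = 1 and m = 3; the
  -- cycle is then constant, against injectivity, as r ≥ 2.
  by_cases hthree : ∃ i, 3 * x i = (a * b : ℕ)
  · obtain ⟨i, hi⟩ := hthree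
    have h1 : IsUnit (x i) := (hcop' i).isUnit_of_dvd' dvd_rfl ⟨3, by rw [← hi, mul_comm]⟩
    have h2 : x i = 1 := by
      rcases Int.isUnit_iff.1 h1 with h | h
      · exact h
      · have := hpos i; omega
    have hone : ∀ k, x k = 1 := fun k => by have := hpos k; have := hle k; omega
    have h01 : (0 : ℕ) = 1 := hinj (by simp; omega) (by simp; omega) (by simp only [hy, hone])
    omega
  · push Not at hthree
    have hb0 : (0 : ℤ) < b := by exact_mod_cast hb.pos
    -- The natural-number quotient is K = ⌈a/3⌉.
    have hlt : ∀ j < r, y j < b * ((a + 2) / 3 : ℕ) := by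
      intro j _
      have h1 := hle (o4 b * j)
      have h2 := hthree (o4 b * j)
      have h3 : 3 * y j < a * b := by push_cast at h1 h2; exact lt_of_le_of_ne h1 h2
      have h4 : (a : ℤ) ≤ 3 * ((a + 2) / 3 : ℕ) := by omega
      nlinarith
    have := card_le_of_modEq hb hm hinj hmod (fun j _ => (hpos _).le) hlt h4
    -- Oddness of a is needed here: the count reaches K/2 + 1 only for K ≡ 2 mod 4, and then a = 3K
    -- - 2 would be even. In the remaining cases the count is at most a/6 + 7/6, below (2a + 15)/12.
    obtain ⟨k, rfl⟩ := ha
    omega
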